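/- Theorem 2. Let $K\subset\mathbb{R}^2$ be a convex body, i.e. a compact convex set with nonempty interior. The following three conditions are equivalent. (1) All touching pairs of translates of $K$ have convex hulls of the same area: there is a constant $c$ such that $\operatorname{area}\bigl(\operatorname{conv}((v+K)\cup(w+K))\bigr)=c$ for all $v,w\in\mathbb{R}^2$ for which $v+K$ and $w+K$ touch, i.e. for which they intersect but have disjoint interiors. (2) The boundary of $\frac12(K-K)=\{\frac12(x-y):x,y\in K\}$ is a Radon curve. (3) $K$ is of constant width in some Radon norm. Here a Radon curve is the boundary $C$ of a convex body symmetric about the origin $o$ such that for some nondegenerate affine image $C'$ of $C$, with convex hull $L=\operatorname{conv} C'$, the polar $L^\circ=\{y:\langle x,y\rangle\le 1 \text{ for all } x\in L\}$ is the image of $L$ under the rotation about $o$ by $\pi/2$. A Radon norm is a norm on $\mathbb{R}^2$ whose unit circle $\{x:\|x\|=1\}$ is a Radon curve. $K$ is of constant width in a norm if the distance, measured in this norm, between two parallel supporting lines of $K$ is the same for all directions. -/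

import Mathlib

open MeasureTheory
open scoped Pointwise

/-- The Euclidean plane. -/
abbrev Plane : Type := EuclideanSpace ℝ (Fin 2)

/-- Two sets touch if they meet but their interiors are disjoint. -/
def Touching (A B : Set Plane) : Prop :=
  (A ∩ B).Nonempty ∧ Disjoint (interior A) (interior B)

/-- The translative constant volume property: the convex hulls of all touching pairs of translates
of `K` have the same area. -/
def TranslativeConstantVolume (K : Set Plane) : Prop :=
  ∃ c : ENNReal, ∀ v w : Plane, Touching (v +ᵥ K) (w +ᵥ K) →
    volume (convexHull ℝ ((v +ᵥ K) ∪ (w +ᵥ K))) = c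

/-- The polar set of `K`. -/
def polarBody (K : Set Plane) : Set Plane :=
  {y | ∀ x ∈ K, inner ℝ x y ≤ 1}

/-- The rotation about the origin by the angle `π / 2`. -/
noncomputable def quarterTurn (x : Plane) : Plane := !₂[-x 1, x 0]

/-- A closed convex curve symmetric about the origin: the boundary of a compact convex set with
nonempty interior which is symmetric about the origin. -/
def IsSymmetricConvexCurve (C : Set Plane) : Prop :=
  ∃ B : Set Plane, Convex ℝ B ∧ IsCompact B ∧ (interior B).Nonempty ∧ -B = B ∧ C = frontier B

/-- A Radon curve: an origin-symmetric convex curve such that the convex hull of a suitable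
(nondegenerate) affine image of it has a polar that is its rotated copy by `π / 2`. -/
def IsRadonCurve (C : Set Plane) : Prop :=
  IsSymmetricConvexCurve C ∧
    ∃ f : Plane ≃ᵃ[ℝ] Plane,
      polarBody (convexHull ℝ (f '' C)) = quarterTurn '' convexHull ℝ (f '' C)

/-- A Radon norm: a norm on the plane (a seminorm vanishing only at `0`) whose unit circle is a
Radon curve. -/
def IsRadonNorm (p : Seminorm ℝ Plane) : Prop :=
  (∀ x, p x = 0 → x = 0) ∧ IsRadonCurve {x | p x = 1}

/-- The supporting line of `K` with (Euclidean) outer normal `u`. -/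
def supportingLine (K : Set Plane) (u : Plane) : Set Plane :=
  {x | inner ℝ u x = sSup ((fun z => inner ℝ u z) '' K)}

/-- The width of `K` in the norm `p`, in the direction with (Euclidean) normal `u`: the
`p`-distance of the two parallel supporting lines of `K` with outer normals `u` and `-u`. -/
noncomputable def minkowskiWidth (p : Seminorm ℝ Plane) (K : Set Plane) (u : Plane) : ℝ :=
  sInf {d | ∃ x ∈ supportingLine K u, ∃ y ∈ supportingLine K (-u), d = p (x - y)}

/-- `K` is of constant width in the norm `p`: all pairs of parallel supporting lines of `K` have
the same `p`-distance. -/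
def HasConstantWidth (p : Seminorm ℝ Plane) (K : Set Plane) : Prop :=
  ∃ c : ℝ, ∀ u : Plane, u ≠ 0 → minkowskiWidth p K u = c

/-! Write D = (K - K)/2, with gauge g and support function h, and J for the quarter turn. Translates
by v and w touch exactly when g(w - v) = 2 (`touching_iff`). The hull of their union is K swept
along the segment from v to w, so its area is area(K) + 2 h(J(w - v))
(`volume_convexHull_union_vadd`). Constant area therefore means that h ∘ J is constant on a sphere
of g, which by homogeneity is h = l · (g ∘ J) for some l > 0.

That identity says that the polar of D is a rotated dilate of D, and `isRadonCurve_frontier_iff`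
shows that this characterizes Radon curves: a self-polar affine image must be centred at the origin,
and a linear map scales the form ⟨x, Jy⟩ by its determinant.

For constant width, the width of K in a norm with unit ball B is 2 h(u) / h_B(u)
(`minkowskiWidth_eq`). It is constant exactly when D is a positive dilate of B, and dilation
preserves the Radon property. -/

/-! ### The quarter turn. -/

theorem inner_plane (x y : Plane) : inner ℝ x y = x 0 * y 0 + x 1 * y 1 := by
  simp [PiLp.inner_apply, Fin.sum_univ_two, mul_comm]

@[simp] theorem quarterTurn_zero_coord (x : Plane) : quarterTurn x 0 = -x 1 := by
  simp [quarterTurn]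

@[simp] theorem quarterTurn_one_coord (x : Plane) : quarterTurn x 1 = x 0 := by
  simp [quarterTurn]

theorem plane_ext {x y : Plane} (h0 : x 0 = y 0) (h1 : x 1 = y 1) : x = y := by
  ext i; fin_cases i <;> assumption

theorem quarterTurn_quarterTurn (x : Plane) : quarterTurn (quarterTurn x) = -x :=
  plane_ext (by simp) (by simp)

theorem quarterTurn_neg (x : Plane) : quarterTurn (-x) = -quarterTurn x :=
  plane_ext (by simp) (by simp)

theorem quarterTurn_smul (a : ℝ) (x : Plane) : quarterTurn (a • x) = a • quarterTurn x :=
  plane_ext (by simp) (by simp)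

theorem quarterTurn_sub (x y : Plane) : quarterTurn (x - y) = quarterTurn x - quarterTurn y :=
  plane_ext (by simp; ring) (by simp)

theorem inner_quarterTurn_self (x : Plane) : inner ℝ x (quarterTurn x) = 0 := by
  simp [inner_plane]; ring

theorem norm_quarterTurn (x : Plane) : ‖quarterTurn x‖ = ‖x‖ := by
  rw [EuclideanSpace.norm_eq, EuclideanSpace.norm_eq]
  simp [Fin.sum_univ_two, add_comm]

/-- `y` lies in the image of `s` under the quarter turn iff its backward quarter turn is in `s`. -/
theorem mem_image_quarterTurn {s : Set Plane} {y : Plane} :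
    y ∈ quarterTurn '' s ↔ -quarterTurn y ∈ s := by
  constructor
  · rintro ⟨x, hx, rfl⟩
    rwa [quarterTurn_quarterTurn, neg_neg]
  · intro h
    exact ⟨_, h, by rw [quarterTurn_neg, quarterTurn_quarterTurn, neg_neg]⟩

theorem isCompact_sub_self {K : Set Plane} (hK : IsCompact K) : IsCompact (K - K) := by
  rw [sub_eq_add_neg]
  exact hK.add hK.neg

/-! ### Support functions of compact sets. -/

/-- The support function. -/
noncomputable def supportFun (K : Set Plane) (u : Plane) : ℝ :=
  sSup ((fun z => inner ℝ u z) '' K)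

section supportFun

variable {K : Set Plane}

theorem bddAbove_inner_image (hK : IsCompact K) (u : Plane) :
    BddAbove ((fun z => inner ℝ u z) '' K) :=
  (hK.image (by fun_prop)).bddAbove

theorem inner_le_supportFun (hK : IsCompact K) (u : Plane) {z : Plane} (hz : z ∈ K) :
    inner ℝ u z ≤ supportFun K u :=
  le_csSup (bddAbove_inner_image hK u) ⟨z, hz, rfl⟩

theorem exists_inner_eq_supportFun (hK : IsCompact K) (hne : K.Nonempty) (u : Plane) :
    ∃ z ∈ K, inner ℝ u z = supportFun K u := by
  obtain ⟨z, hz, h⟩ := (hK.image (f := fun z => inner ℝ u z) (by fun_prop)).sSup_mem (hne.image _)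
  exact ⟨z, hz, h⟩

theorem supportFun_le_iff (hK : IsCompact K) (hne : K.Nonempty) {u : Plane} {a : ℝ} :
    supportFun K u ≤ a ↔ ∀ z ∈ K, inner ℝ u z ≤ a := by
  refine ⟨fun h z hz => (inner_le_supportFun hK u hz).trans h, fun h => ?_⟩
  obtain ⟨z, hz, e⟩ := exists_inner_eq_supportFun hK hne u
  exact e ▸ h z hz

theorem supportFun_smul_right (hK : IsCompact K) (hne : K.Nonempty) {a : ℝ} (ha : 0 ≤ a)
    (u : Plane) : supportFun K (a • u) = a * supportFun K u := by
  apply le_antisymm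
  · rw [supportFun_le_iff hK hne]
    intro z hz
    rw [real_inner_smul_left]
    exact mul_le_mul_of_nonneg_left (inner_le_supportFun hK u hz) ha
  · obtain ⟨z, hz, e⟩ := exists_inner_eq_supportFun hK hne u
    rw [← e, ← real_inner_smul_left]
    exact inner_le_supportFun hK _ hz

theorem supportFun_smul_left (hK : IsCompact K) (hne : K.Nonempty) {a : ℝ} (ha : 0 ≤ a)
    (u : Plane) : supportFun (a • K) u = a * supportFun K u := by
  apply le_antisymm
  · rw [supportFun_le_iff (hK.smul a) hne.smul_set]
    rintro _ ⟨z, hz, rfl⟩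
    simp only [real_inner_smul_right]
    exact mul_le_mul_of_nonneg_left (inner_le_supportFun hK u hz) ha
  · obtain ⟨z, hz, e⟩ := exists_inner_eq_supportFun hK hne u
    rw [← e, ← real_inner_smul_right]
    exact inner_le_supportFun (hK.smul a) _ (Set.smul_mem_smul_set hz)

theorem supportFun_sub (hK : IsCompact K) (hne : K.Nonempty) (u : Plane) :
    supportFun (K - K) u = supportFun K u + supportFun K (-u) := by
  apply le_antisymm
  · rw [supportFun_le_iff (isCompact_sub_self hK) (hne.sub hne)]
    rintro _ ⟨x, hx, y, hy, rfl⟩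
    have h1 := inner_le_supportFun hK u hx
    have h2 := inner_le_supportFun hK (-u) hy
    rw [inner_neg_left] at h2
    simp only [inner_sub_right]
    linarith
  · obtain ⟨x, hx, ex⟩ := exists_inner_eq_supportFun hK hne u
    obtain ⟨y, hy, ey⟩ := exists_inner_eq_supportFun hK hne (-u)
    have h := inner_le_supportFun (isCompact_sub_self hK) u (Set.sub_mem_sub hx hy)
    rw [inner_sub_right] at h
    rw [inner_neg_left] at ey
    linarith

/-- Hahn–Banach: a point of K outside L would be separated from L by a linear functional. Used in
both directions, this recovers a convex body from its support function. -/
theorem subset_of_supportFun_le {L : Set Plane} (hK : IsCompact K) (hL : IsCompact L)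
    (hLc : Convex ℝ L) (hLne : L.Nonempty) (h : ∀ u, supportFun K u ≤ supportFun L u) :
    K ⊆ L := by
  intro x hx
  by_contra hxL
  obtain ⟨f, a, h1, h2⟩ := geometric_hahn_banach_closed_point hLc hL.isClosed hxL
  set u := (InnerProductSpace.toDual ℝ Plane).symm f
  have hf : ∀ z, inner ℝ u z = f z := fun z => InnerProductSpace.toDual_symm_apply
  have h3 : supportFun L u ≤ a :=
    (supportFun_le_iff hL hLne).2 fun z hz => (hf z).le.trans (h1 z hz).le
  have h4 := inner_le_supportFun hK u hx
  rw [hf] at h4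
  linarith [h u]

theorem image_inner_eq_Icc (hK : IsCompact K) (hne : K.Nonempty) (hc : Convex ℝ K) (u : Plane) :
    (fun z => inner ℝ u z) '' K = Set.Icc (-supportFun K (-u)) (supportFun K u) := by
  apply Set.Subset.antisymm
  · rintro _ ⟨z, hz, rfl⟩
    have h2 := inner_le_supportFun hK (-u) hz
    rw [inner_neg_left] at h2
    exact ⟨by simp only; linarith, inner_le_supportFun hK u hz⟩
  · obtain ⟨x, hx, ex⟩ := exists_inner_eq_supportFun hK hne u
    obtain ⟨y, hy, ey⟩ := exists_inner_eq_supportFun hK hne (-u)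
    rw [inner_neg_left] at ey
    have : IsPreconnected ((fun z : Plane => inner ℝ u z) '' K) :=
      hc.isPreconnected.image _ (by fun_prop)
    exact this.ordConnected.out ⟨y, hy, by simp only; linarith⟩ ⟨x, hx, ex⟩

end supportFun

/-! ### Symmetric bodies, their gauges and support functions. -/

/-- A planar convex body symmetric about the origin. -/
structure IsSymmetricBody (B : Set Plane) : Prop where
  convex : Convex ℝ B
  isCompact : IsCompact B
  interior_nonempty : (interior B).Nonempty
  neg_eq : -B = B

namespace IsSymmetricBody

variable {B : Set Plane}

theorem neg_mem (hB : IsSymmetricBody B) {x : Plane} : -x ∈ B ↔ x ∈ B := by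
  rw [← Set.mem_neg, hB.neg_eq]

theorem mem_nhds_zero (hB : IsSymmetricBody B) : B ∈ nhds (0 : Plane) := by
  obtain ⟨x, hx⟩ := hB.interior_nonempty
  have hx' : -x ∈ B := hB.neg_mem.2 (interior_subset hx)
  have h := hB.convex.openSegment_interior_self_subset_interior hx hx'
  apply mem_interior_iff_mem_nhds.1
  apply h
  exact ⟨1 / 2, 1 / 2, by norm_num, by norm_num, by norm_num, by simp⟩

theorem zero_mem (hB : IsSymmetricBody B) : (0 : Plane) ∈ B := mem_of_mem_nhds hB.mem_nhds_zero

theorem nonempty (hB : IsSymmetricBody B) : B.Nonempty := ⟨0, hB.zero_mem⟩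

theorem absorbent (hB : IsSymmetricBody B) : Absorbent ℝ B :=
  absorbent_nhds_zero hB.mem_nhds_zero

theorem gauge_le_one_iff (hB : IsSymmetricBody B) {x : Plane} : gauge B x ≤ 1 ↔ x ∈ B := by
  rw [gauge_le_one_iff_mem_closure hB.convex hB.mem_nhds_zero, hB.isCompact.isClosed.closure_eq]

theorem gauge_eq_one_iff (hB : IsSymmetricBody B) {x : Plane} :
    gauge B x = 1 ↔ x ∈ frontier B :=
  gauge_eq_one_iff_mem_frontier hB.convex hB.mem_nhds_zero

theorem gauge_neg (hB : IsSymmetricBody B) (x : Plane) : gauge B (-x) = gauge B x :=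
  _root_.gauge_neg (fun _ hx => hB.neg_mem.2 hx) x

theorem gauge_eq_zero_iff (hB : IsSymmetricBody B) {x : Plane} : gauge B x = 0 ↔ x = 0 :=
  gauge_eq_zero hB.absorbent
    (NormedSpace.isVonNBounded_of_isBounded ℝ hB.isCompact.isBounded)

theorem gauge_pos (hB : IsSymmetricBody B) {x : Plane} (hx : x ≠ 0) : 0 < gauge B x :=
  (gauge_nonneg x).lt_of_ne fun h => hx (hB.gauge_eq_zero_iff.1 h.symm)

theorem gauge_normalize (hB : IsSymmetricBody B) {x : Plane} (hx : x ≠ 0) :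
    gauge B ((gauge B x)⁻¹ • x) = 1 := by
  rw [gauge_smul_of_nonneg (inv_nonneg.2 (gauge_nonneg x)), smul_eq_mul,
    inv_mul_cancel₀ (hB.gauge_pos hx).ne']

theorem convexHull_frontier (hB : IsSymmetricBody B) : convexHull ℝ (frontier B) = B := by
  apply Set.Subset.antisymm
  · exact convexHull_min hB.isCompact.isClosed.frontier_subset hB.convex
  · have key : ∀ x ∈ B, x ≠ 0 → x ∈ convexHull ℝ (frontier B) := by
      intro x hx hx0
      set g := gauge B x with hg
      have hg0 : 0 < g := hB.gauge_pos hx0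
      have hg1 : g ≤ 1 := hB.gauge_le_one_iff.2 hx
      have h1 : g⁻¹ • x ∈ frontier B := hB.gauge_eq_one_iff.1 (hB.gauge_normalize hx0)
      have h2 : -(g⁻¹ • x) ∈ frontier B := by
        rw [← hB.gauge_eq_one_iff, hB.gauge_neg, hB.gauge_eq_one_iff]; exact h1
      -- x lies on the chord joining the boundary points ± x / g; the weights solve (a - b) / g = 1
      -- with a + b = 1.
      refine (convex_convexHull ℝ _).segment_subset (subset_convexHull ℝ _ h1)
        (subset_convexHull ℝ _ h2) ⟨(1 + g) / 2, (1 - g) / 2, by linarith, by linarith,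
          by ring, ?_⟩
      rw [smul_neg, smul_smul, smul_smul, ← sub_eq_add_neg, ← sub_smul]
      have : (1 + g) / 2 * g⁻¹ - (1 - g) / 2 * g⁻¹ = 1 := by field_simp; ring
      rw [this, one_smul]
    intro x hx
    by_cases hx0 : x = 0
    · obtain ⟨e, he⟩ := exists_ne (0 : Plane)
      have h1 : (gauge B e)⁻¹ • e ∈ B := hB.gauge_le_one_iff.1 (hB.gauge_normalize he).le
      have h0 : (gauge B e)⁻¹ • e ≠ 0 := smul_ne_zero (inv_ne_zero (hB.gauge_pos he).ne') he
      have h3 := key _ h1 h0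
      have h4 := key _ (hB.neg_mem.2 h1) (neg_ne_zero.2 h0)
      rw [hx0]
      refine (convex_convexHull ℝ _).segment_subset h3 h4
        ⟨1 / 2, 1 / 2, by norm_num, by norm_num, by norm_num, by simp⟩
    · exact key x hx hx0

theorem supportFun_pos (hB : IsSymmetricBody B) {u : Plane} (hu : u ≠ 0) :
    0 < supportFun B u := by
  have h1 : (gauge B u)⁻¹ • u ∈ B := hB.gauge_le_one_iff.1 (hB.gauge_normalize hu).le
  refine lt_of_lt_of_le ?_ (inner_le_supportFun hB.isCompact u h1)
  rw [real_inner_smul_right]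
  exact mul_pos (inv_pos.2 (hB.gauge_pos hu)) (real_inner_self_pos.2 hu)

theorem supportFun_neg (hB : IsSymmetricBody B) (u : Plane) :
    supportFun B (-u) = supportFun B u := by
  have h : ∀ v, supportFun B (-v) ≤ supportFun B v := fun v => by
    rw [supportFun_le_iff hB.isCompact hB.nonempty]
    intro z hz
    rw [inner_neg_left, ← inner_neg_right]
    exact inner_le_supportFun hB.isCompact v (hB.neg_mem.2 hz)
  exact le_antisymm (h u) (by simpa using h (-u))

theorem supportFun_zero (hB : IsSymmetricBody B) : supportFun B 0 = 0 := by
  simpa using supportFun_smul_right hB.isCompact hB.nonempty le_rfl (0 : Plane)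

theorem mem_polarBody_iff (hB : IsSymmetricBody B) {u : Plane} :
    u ∈ polarBody B ↔ supportFun B u ≤ 1 := by
  rw [supportFun_le_iff hB.isCompact hB.nonempty]
  exact forall₂_congr fun z _ => by rw [real_inner_comm]

theorem inner_le_supportFun_mul_gauge (hB : IsSymmetricBody B) (u x : Plane) :
    inner ℝ u x ≤ supportFun B u * gauge B x := by
  by_cases hx : x = 0
  · simp [hx]
  have h := inner_le_supportFun hB.isCompact u (hB.gauge_le_one_iff.1 (hB.gauge_normalize hx).le)
  rw [real_inner_smul_right, inv_mul_le_iff₀ (hB.gauge_pos hx)] at h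
  linarith

protected theorem smul (hB : IsSymmetricBody B) {a : ℝ} (ha : a ≠ 0) :
    IsSymmetricBody (a • B) where
  convex := hB.convex.smul a
  isCompact := hB.isCompact.smul a
  interior_nonempty := by
    rw [interior_smul₀ ha]; exact hB.interior_nonempty.smul_set
  neg_eq := by rw [← Set.smul_set_neg, hB.neg_eq]

end IsSymmetricBody

/-- The difference body, up to the factor two: the central symmetral of a convex body. -/
theorem isSymmetricBody_halfDiff {K : Set Plane} (hc : Convex ℝ K) (hK : IsCompact K)
    (hi : (interior K).Nonempty) : IsSymmetricBody ((1 / 2 : ℝ) • (K - K)) := by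
  have h : IsSymmetricBody (K - K) :=
    { convex := hc.sub hc
      isCompact := isCompact_sub_self hK
      interior_nonempty :=
        (hi.sub hi).mono (interior_maximal (Set.sub_subset_sub interior_subset interior_subset)
          isOpen_interior.sub_right)
      neg_eq := neg_sub K K }
  exact h.smul (by norm_num)

theorem supportFun_halfDiff {K : Set Plane} (hK : IsCompact K) (hne : K.Nonempty) (u : Plane) :
    2 * supportFun ((1 / 2 : ℝ) • (K - K)) u = supportFun K u + supportFun K (-u) := by
  rw [supportFun_smul_left (isCompact_sub_self hK) (hne.sub hne) (by norm_num), supportFun_sub hK hne]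
  ring

/-! ### Unit balls of norms. -/

theorem continuous_seminorm_plane (p : Seminorm ℝ Plane) : Continuous p := by
  rw [← continuousOn_univ]
  exact p.convexOn.continuousOn isOpen_univ

theorem isSymmetricBody_seminorm {p : Seminorm ℝ Plane} (hp : ∀ x, p x = 0 → x = 0) :
    IsSymmetricBody {x | p x ≤ 1} where
  convex := by
    have := p.convex_closedBall 0 1
    rwa [Seminorm.closedBall_zero_eq] at this
  isCompact := by
    obtain ⟨e, he⟩ := NormedSpace.sphere_nonempty (E := Plane) (x := 0) (r := 1) |>.2 zero_le_one
    -- The positive minimum of p on the Euclidean unit sphere bounds the p-ball by a Euclidean ball.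
    obtain ⟨m, hm, hmin⟩ := (isCompact_sphere (0 : Plane) 1).exists_isMinOn ⟨e, he⟩
      (continuous_seminorm_plane p).continuousOn
    have hm0 : 0 < p m := (apply_nonneg p m).lt_of_ne fun h => by
      rw [hp m h.symm] at hm
      simp at hm
    refine Metric.isCompact_of_isClosed_isBounded
      (isClosed_le (continuous_seminorm_plane p) continuous_const)
      ((Metric.isBounded_closedBall (x := (0 : Plane)) (r := (p m)⁻¹)).subset fun x hx => ?_)
    rw [mem_closedBall_zero_iff]
    by_cases hx0 : x = 0
    · rw [hx0, norm_zero]; positivity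
    have hxn : 0 < ‖x‖ := norm_pos_iff.2 hx0
    have h1 : ‖x‖⁻¹ • x ∈ Metric.sphere (0 : Plane) 1 := by
      rw [mem_sphere_zero_iff_norm, norm_smul, norm_inv, norm_norm, inv_mul_cancel₀ hxn.ne']
    have h2 : p m ≤ p (‖x‖⁻¹ • x) := hmin h1
    rw [map_smul_eq_mul, norm_inv, norm_norm, le_inv_mul_iff₀ hxn] at h2
    rw [le_inv_comm₀ hxn hm0, inv_eq_one_div, le_div_iff₀ hxn]
    have h3 : p x ≤ 1 := hx
    linarith
  interior_nonempty := by
    refine ⟨0, mem_interior_iff_mem_nhds.2 ?_⟩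
    refine Filter.mem_of_superset
      ((isOpen_lt (continuous_seminorm_plane p) continuous_const).mem_nhds
        (show p 0 < 1 by simp)) fun x (hx : p x < 1) =>
        (hx.le : p x ≤ 1)
  neg_eq := by
    ext x
    simp

theorem gauge_seminorm {p : Seminorm ℝ Plane} (hp : ∀ x, p x = 0 → x = 0) :
    gauge {x | p x ≤ 1} = p := by
  have hB := isSymmetricBody_seminorm hp
  apply le_antisymm
  · conv_rhs => rw [← p.gauge_ball]
    refine gauge_mono (p.absorbent_ball_zero one_pos) fun x hx => ?_
    rw [Seminorm.mem_ball_zero] at hx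
    exact hx.le
  · intro x
    by_cases hx : x = 0
    · simp [hx]
    have h : p ((gauge {x | p x ≤ 1} x)⁻¹ • x) ≤ 1 :=
      hB.gauge_le_one_iff.1 (hB.gauge_normalize hx).le
    have h0 := hB.gauge_pos hx
    rw [map_smul_eq_mul, norm_inv, Real.norm_of_nonneg h0.le, inv_mul_le_iff₀ h0, mul_one] at h
    exact h

theorem frontier_seminorm {p : Seminorm ℝ Plane} (hp : ∀ x, p x = 0 → x = 0) :
    frontier {x | p x ≤ 1} = {x | p x = 1} := by
  ext x
  rw [← (isSymmetricBody_seminorm hp).gauge_eq_one_iff, gauge_seminorm hp]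
  rfl

/-! ### Analytic form of the Radon condition. -/

theorem le_of_homogeneous_of_le_one {F G : Plane → ℝ} (hF : ∀ a : ℝ, 0 ≤ a → ∀ z, F (a • z) = a * F z)
    (hG : ∀ a : ℝ, 0 ≤ a → ∀ z, G (a • z) = a * G z) (hG0 : ∀ z, 0 ≤ G z)
    (h : ∀ z, G z ≤ 1 → F z ≤ 1) (z : Plane) : F z ≤ G z := by
  refine le_of_forall_gt_imp_ge_of_dense fun a ha => ?_
  have ha0 : 0 < a := (hG0 z).trans_lt ha
  have h1 := h (a⁻¹ • z) (by
    rw [hG _ (inv_nonneg.2 ha0.le), inv_mul_le_iff₀ ha0, mul_one]; exact ha.le)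
  rwa [hF _ (inv_nonneg.2 ha0.le), inv_mul_le_iff₀ ha0, mul_one] at h1

/-- Both sides of the functional identity are nonnegative and positively homogeneous, hence
determined by their unit sublevel sets. -/
theorem supportFun_eq_iff_mem_polarBody {B : Set Plane} (hB : IsSymmetricBody B) {l : ℝ}
    (hl : 0 < l) :
    (∀ z, supportFun B z = l * gauge B (quarterTurn z)) ↔
      ∀ z, z ∈ polarBody B ↔ l • quarterTurn z ∈ B := by
  have hg : ∀ z, l • quarterTurn z ∈ B ↔ l * gauge B (quarterTurn z) ≤ 1 := fun z => by
    rw [← hB.gauge_le_one_iff, gauge_smul_of_nonneg hl.le, smul_eq_mul]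
  have hF : ∀ a : ℝ, 0 ≤ a → ∀ z, supportFun B (a • z) = a * supportFun B z :=
    fun a ha z => supportFun_smul_right hB.isCompact hB.nonempty ha z
  have hG : ∀ a : ℝ, 0 ≤ a → ∀ z,
      l * gauge B (quarterTurn (a • z)) = a * (l * gauge B (quarterTurn z)) := fun a ha z => by
    rw [quarterTurn_smul, gauge_smul_of_nonneg ha, smul_eq_mul]; ring
  have hF0 : ∀ z, 0 ≤ supportFun B z := fun z => by
    by_cases hz : z = 0
    · rw [hz, hB.supportFun_zero]
    · exact (hB.supportFun_pos hz).le
  have hG0 : ∀ z, 0 ≤ l * gauge B (quarterTurn z) := fun z => mul_nonneg hl.le (gauge_nonneg _)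
  simp only [hg, hB.mem_polarBody_iff]
  constructor
  · intro h z
    rw [h]
  · intro h z
    exact le_antisymm (le_of_homogeneous_of_le_one hF hG hG0 (fun z => (h z).2) z)
      (le_of_homogeneous_of_le_one hG hF hF0 (fun z => (h z).1) z)

/-- A bounded centrally symmetric set whose polar is its rotation by a quarter turn is centred at
the origin. -/
theorem center_eq_zero_of_polarBody_eq {L : Set Plane} {c : Plane}
    (hb : Bornology.IsBounded L) (hL : ∀ x ∈ L, (2 : ℝ) • c - x ∈ L)
    (h : polarBody L = quarterTurn '' L) : c = 0 := by
  set d := quarterTurn c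
  have hsymm : ∀ y ∈ polarBody L, (2 : ℝ) • d - y ∈ polarBody L := by
    intro y hy
    rw [h] at hy ⊢
    obtain ⟨x, hx, rfl⟩ := hy
    exact ⟨_, hL x hx, by rw [quarterTurn_sub, quarterTurn_smul]⟩
  -- Testing y against 2c - x gives -⟨x, y⟩ ≤ 1 - 2⟨c, y⟩.
  have hneg : ∀ y ∈ polarBody L, 0 ≤ inner ℝ c y → -y ∈ polarBody L := by
    intro y hy hcy x hx
    have := hy _ (hL x hx)
    rw [inner_sub_left, real_inner_smul_left] at this
    rw [inner_neg_right]
    linarith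
  -- Since d is orthogonal to c, negation followed by reflection in d keeps multiples of d in the
  -- polar and moves them by 2d. This contradicts boundedness unless c = 0.
  have hmem : ∀ n : ℕ, (2 * n : ℝ) • d ∈ polarBody L := by
    intro n
    induction n with
    | zero => intro x _; simp
    | succ n ih =>
      have h0 : inner ℝ c ((2 * n : ℝ) • d) = 0 := by
        rw [real_inner_smul_right, inner_quarterTurn_self, mul_zero]
      have h1 := hsymm _ (hneg _ ih h0.ge)
      rw [sub_neg_eq_add, ← add_smul] at h1
      convert h1 using 2
      push_cast
      ring
  obtain ⟨r, hr⟩ := hb.exists_norm_le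
  have hnorm : ∀ n : ℕ, 2 * n * ‖c‖ ≤ r := by
    intro n
    have h1 := hmem n
    rw [h] at h1
    obtain ⟨x, hx, e⟩ := h1
    have h2 := hr x hx
    rw [← norm_quarterTurn, e, norm_smul, norm_quarterTurn, Real.norm_of_nonneg (by positivity)]
      at h2
    exact h2
  by_contra hc
  have hc0 : 0 < ‖c‖ := norm_pos_iff.2 hc
  obtain ⟨n, hn⟩ := exists_nat_gt (r / ‖c‖)
  rw [div_lt_iff₀ hc0] at hn
  have := hnorm n
  nlinarith [mul_nonneg n.cast_nonneg hc0.le]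

/-- ⟨x, Jy⟩ is an area form, so δ is the determinant of T. -/
theorem inner_linearMap_quarterTurn (T : Plane →ₗ[ℝ] Plane) :
    ∃ δ : ℝ, ∀ x y, inner ℝ (T x) (quarterTurn (T y)) = δ * inner ℝ x (quarterTurn y) := by
  have hT : ∀ x : Plane, T x = x 0 • T (EuclideanSpace.single 0 1) +
      x 1 • T (EuclideanSpace.single 1 1) := fun x => by
    rw [← map_smul, ← map_smul, ← map_add]
    congr 1
    exact plane_ext (by simp) (by simp)
  refine ⟨T (EuclideanSpace.single 0 1) 0 * T (EuclideanSpace.single 1 1) 1 -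
    T (EuclideanSpace.single 0 1) 1 * T (EuclideanSpace.single 1 1) 0, fun x y => ?_⟩
  rw [hT x, hT y]
  simp only [inner_plane, quarterTurn_zero_coord, quarterTurn_one_coord, PiLp.add_apply,
    PiLp.smul_apply, smul_eq_mul]
  ring

theorem isRadonCurve_frontier_iff {B : Set Plane} (hB : IsSymmetricBody B) :
    IsRadonCurve (frontier B) ↔
      ∃ l : ℝ, 0 < l ∧ ∀ z, supportFun B z = l * gauge B (quarterTurn z) := by
  have hhull : ∀ f : Plane ≃ᵃ[ℝ] Plane, convexHull ℝ (f '' frontier B) = f '' B := fun f => by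
    have := (f : Plane →ᵃ[ℝ] Plane).image_convexHull (frontier B)
    rw [hB.convexHull_frontier] at this
    exact this.symm
  constructor
  · rintro ⟨-, f, hf⟩
    rw [hhull] at hf
    have hf_eq : ∀ x, f x = f.linear x + f 0 := fun x => by
      simpa using f.map_vadd 0 x
    have hc : f 0 = 0 := by
      refine center_eq_zero_of_polarBody_eq
        (hB.isCompact.image f.toAffineMap.continuous_of_finiteDimensional).isBounded ?_ hf
      rintro _ ⟨x, hx, rfl⟩
      refine ⟨-x, hB.neg_mem.2 hx, ?_⟩
      change f (-x) = (2 : ℝ) • f 0 - f x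
      rw [hf_eq (-x), hf_eq x, map_neg, two_smul]
      abel
    simp only [hc, add_zero] at hf_eq
    obtain ⟨δ, hδ⟩ := inner_linearMap_quarterTurn f.linear.toLinearMap
    simp only [LinearEquiv.coe_coe, ← hf_eq] at hδ
    have hδ0 : δ ≠ 0 := by
      rintro rfl
      obtain ⟨e, he⟩ := exists_ne (0 : Plane)
      obtain ⟨x, hx⟩ := f.surjective (quarterTurn e)
      obtain ⟨y, hy⟩ := f.surjective e
      have := hδ x y
      rw [hx, hy, zero_mul, real_inner_self_eq_norm_sq, norm_quarterTurn] at this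
      exact he (norm_eq_zero.1 (pow_eq_zero_iff two_ne_zero |>.1 this))
    have key : ∀ z, z ∈ polarBody B ↔ δ⁻¹ • quarterTurn z ∈ B := by
      intro z
      have h1 : f (δ⁻¹ • quarterTurn z) ∈ f '' B ↔ δ⁻¹ • quarterTurn z ∈ B :=
        f.injective.mem_set_image
      have h2 : quarterTurn (f (δ⁻¹ • quarterTurn z)) ∈ quarterTurn '' (f '' B) ↔
          f (δ⁻¹ • quarterTurn z) ∈ f '' B := by
        rw [mem_image_quarterTurn, quarterTurn_quarterTurn, neg_neg]
      rw [← h1, ← h2, ← hf]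
      have h3 : ∀ x, inner ℝ (f x) (quarterTurn (f (δ⁻¹ • quarterTurn z))) = -inner ℝ x z :=
        fun x => by
          rw [hδ, quarterTurn_smul, quarterTurn_quarterTurn, real_inner_smul_right,
            mul_inv_cancel_left₀ hδ0, inner_neg_right]
      simp only [polarBody, Set.mem_ofPred_eq, Set.forall_mem_image, h3]
      constructor
      · intro h x hx
        simpa using h _ (hB.neg_mem.2 hx)
      · intro h x hx
        simpa using h (hB.neg_mem.2 hx)
    -- The affine map may reverse orientation; symmetry of B absorbs the sign of δ.
    have habs : ∀ w : Plane, |δ⁻¹| • w ∈ B ↔ δ⁻¹ • w ∈ B := fun w => by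
      rcases abs_choice δ⁻¹ with h | h <;> rw [h]
      rw [neg_smul, hB.neg_mem]
    have hpos : 0 < |δ⁻¹| := abs_pos.2 (inv_ne_zero hδ0)
    exact ⟨|δ⁻¹|, hpos, (supportFun_eq_iff_mem_polarBody hB hpos).2 fun z => by
      rw [key, habs]⟩
  · rintro ⟨l, hl, h⟩
    rw [supportFun_eq_iff_mem_polarBody hB hl] at h
    refine ⟨⟨B, hB.convex, hB.isCompact, hB.interior_nonempty, hB.neg_eq, rfl⟩, ?_⟩
    -- Dilating B by s divides its polar by s, so self-polarity up to rotation requires l * s = s⁻¹.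
    set s := (√l)⁻¹ with hs
    have hs0 : s ≠ 0 := inv_ne_zero (Real.sqrt_pos.2 hl).ne'
    have hls : l * s = s⁻¹ := by
      rw [hs, inv_inv, ← div_eq_mul_inv, Real.div_sqrt]
    refine ⟨(LinearEquiv.smulOfNeZero ℝ Plane s hs0).toAffineEquiv, ?_⟩
    rw [hhull]
    have himg : (LinearEquiv.smulOfNeZero ℝ Plane s hs0).toAffineEquiv '' B = s • B := rfl
    rw [himg]
    ext y
    have h1 : y ∈ polarBody (s • B) ↔ s • y ∈ polarBody B := by
      simp only [polarBody, Set.mem_ofPred_eq, ← Set.image_smul, Set.forall_mem_image,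
        real_inner_smul_left, real_inner_smul_right]
    rw [h1, h, mem_image_quarterTurn, Set.mem_smul_set_iff_inv_smul_mem₀ hs0, quarterTurn_smul,
      smul_smul, hls, smul_neg, hB.neg_mem]

/-! ### Width in a norm. -/

theorem minkowskiWidth_eq {p : Seminorm ℝ Plane} (hp : ∀ x, p x = 0 → x = 0) {K : Set Plane}
    (hK : IsCompact K) (hne : K.Nonempty) {u : Plane} (hu : u ≠ 0) :
    minkowskiWidth p K u =
      (supportFun K u + supportFun K (-u)) / supportFun {x | p x ≤ 1} u := by
  have hB := isSymmetricBody_seminorm hp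
  set B := {x | p x ≤ 1} with hBdef
  have hpos := hB.supportFun_pos hu
  have hW : 0 ≤ supportFun K u + supportFun K (-u) := by
    obtain ⟨z, hz⟩ := hne
    have h1 := inner_le_supportFun hK u hz
    have h2 := inner_le_supportFun hK (-u) hz
    rw [inner_neg_left] at h2
    linarith
  set W := supportFun K u + supportFun K (-u) with hWdef
  refine IsLeast.csInf_eq ⟨?_, ?_⟩
  -- The infimum is attained by crossing the strip along b, a point where the unit ball has
  -- supporting normal u.
  · obtain ⟨b, hb, eb⟩ := exists_inner_eq_supportFun hB.isCompact hB.nonempty u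
    obtain ⟨y, hy, ey⟩ := exists_inner_eq_supportFun hK hne (-u)
    have hpb : p b = 1 := by
      refine le_antisymm hb ?_
      have h1 := hB.inner_le_supportFun_mul_gauge u b
      rw [gauge_seminorm hp, eb] at h1
      exact (le_mul_iff_one_le_right hpos).1 h1
    refine ⟨y + (W / supportFun B u) • b, ?_, y, ey, ?_⟩
    · rw [inner_neg_left] at ey
      have : inner ℝ u (y + (W / supportFun B u) • b) = supportFun K u := by
        rw [inner_add_right, real_inner_smul_right, eb, div_mul_cancel₀ _ hpos.ne']
        linarith
      exact this
    · rw [add_sub_cancel_left, map_smul_eq_mul, hpb, mul_one,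
        Real.norm_of_nonneg (div_nonneg hW hpos.le)]
  · rintro _ ⟨x, hx, y, hy, rfl⟩
    have hx : inner ℝ u x = supportFun K u := hx
    have hy : inner ℝ (-u) y = supportFun K (-u) := hy
    rw [inner_neg_left] at hy
    have h1 := hB.inner_le_supportFun_mul_gauge u (x - y)
    rw [gauge_seminorm hp, inner_sub_right] at h1
    rw [div_le_iff₀ hpos]
    linarith

/-! ### Touching translates. -/

theorem touching_iff {K : Set Plane} (hc : Convex ℝ K) (hK : IsCompact K)
    (hi : (interior K).Nonempty) (v w : Plane) :
    Touching (v +ᵥ K) (w +ᵥ K) ↔ gauge ((1 / 2 : ℝ) • (K - K)) (w - v) = 2 := by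
  have hD := isSymmetricBody_halfDiff hc hK hi
  set D := (1 / 2 : ℝ) • (K - K) with hDdef
  have hhalf : ∀ t : Plane, (1 / 2 : ℝ) • t ∈ D ↔ t ∈ K - K := fun t =>
    Set.smul_mem_smul_set_iff₀ (by norm_num) _ _
  have hg : ∀ t : Plane, gauge D ((1 / 2 : ℝ) • t) = gauge D t / 2 := fun t => by
    rw [gauge_smul_of_nonneg (by norm_num), smul_eq_mul]; ring
  have h1 : ((v +ᵥ K) ∩ (w +ᵥ K)).Nonempty ↔ gauge D (w - v) ≤ 2 := by
    have : gauge D (w - v) ≤ 2 ↔ w - v ∈ K - K := by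
      rw [← hhalf, ← hD.gauge_le_one_iff, hg, div_le_one two_pos]
    rw [this]
    constructor
    · rintro ⟨_, ⟨x, hx, rfl⟩, y, hy, e⟩
      refine ⟨x, hx, y, hy, ?_⟩
      simp only [vadd_eq_add] at e ⊢
      rw [sub_eq_sub_iff_add_eq_add, add_comm x, e]
    · rintro ⟨x, hx, y, hy, e⟩
      refine ⟨v + x, ⟨x, hx, rfl⟩, y, hy, ?_⟩
      simp only [vadd_eq_add] at e ⊢
      rw [sub_eq_sub_iff_add_eq_add] at e
      rw [← e, add_comm]
  have h2 : Disjoint (interior (v +ᵥ K)) (interior (w +ᵥ K)) ↔ 2 ≤ gauge D (w - v) := by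
    rw [← not_lt, ← not_iff_not, not_not, Set.not_disjoint_iff, interior_vadd, interior_vadd]
    have hint : interior K - interior K ⊆ interior (K - K) :=
      interior_maximal (Set.sub_subset_sub interior_subset interior_subset)
        isOpen_interior.sub_right
    constructor
    · rintro ⟨_, ⟨x, hx, rfl⟩, y, hy, e⟩
      have h3 : w - v ∈ interior K - interior K := by
        refine ⟨x, hx, y, hy, ?_⟩
        simp only [vadd_eq_add] at e ⊢
        rw [sub_eq_sub_iff_add_eq_add, add_comm x, e]
      have h4 : (1 / 2 : ℝ) • (w - v) ∈ interior D := by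
        rw [hDdef, interior_smul₀ (by norm_num)]
        exact Set.smul_mem_smul_set (hint h3)
      rw [← gauge_lt_one_iff_mem_interior hD.convex hD.mem_nhds_zero, hg] at h4
      linarith
    · intro h
      obtain ⟨m, hm⟩ := hi
      -- With w - v = r(x - y) and r < 1, contracting x and y towards the interior point m by the
      -- factor r makes both interior and leaves the difference w - v. The maximum with 0 keeps r
      -- positive even when w = v.
      obtain ⟨r, hr1, hr2⟩ := exists_between (show max 0 (gauge D (w - v) / 2) < 1 by
        rw [max_lt_iff]; constructor <;> linarith)
      have hr0 : 0 < r := (le_max_left _ _).trans_lt hr1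
      have hmem : r⁻¹ • (w - v) ∈ K - K := by
        rw [← hhalf, ← hD.gauge_le_one_iff, hg, gauge_smul_of_nonneg (inv_nonneg.2 hr0.le),
          smul_eq_mul, mul_div_assoc, inv_mul_le_iff₀ hr0, mul_one]
        exact ((le_max_right _ _).trans_lt hr1).le
      obtain ⟨x, hx, y, hy, e⟩ := hmem
      have hin : ∀ z ∈ K, (1 - r) • m + r • z ∈ interior K := fun z hz =>
        hc.openSegment_interior_self_subset_interior hm hz
          ⟨1 - r, r, by linarith, hr0, by ring, rfl⟩
      refine ⟨v + ((1 - r) • m + r • x), ⟨_, hin x hx, rfl⟩, _, hin y hy, ?_⟩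
      simp only [vadd_eq_add] at e ⊢
      have e2 : w = v + r • (x - y) := by
        rw [e, smul_smul, mul_inv_cancel₀ hr0.ne', one_smul]; abel
      rw [e2, smul_sub]
      abel
  rw [Touching, h1, h2, le_antisymm_iff]

/-! ### Area swept along a segment. -/

/-- Each nonempty horizontal slice is a compact interval and grows by length 1; empty slices stay
empty. Integration over y then yields the height of s. -/
theorem volume_preimage_add_segment {s : Set (ℝ × ℝ)} (hs : Convex ℝ s) (hc : IsCompact s)
    (y : ℝ) :
    volume ((fun x => (x, y)) ⁻¹' (s + Set.Icc (0 : ℝ) 1 ×ˢ {(0 : ℝ)})) =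
      volume ((fun x => (x, y)) ⁻¹' s) + (Prod.snd '' s).indicator 1 y := by
  set S := (fun x : ℝ => (x, y)) ⁻¹' s with hS
  have hadd : (fun x => (x, y)) ⁻¹' (s + Set.Icc (0 : ℝ) 1 ×ˢ {(0 : ℝ)}) = S + Set.Icc 0 1 := by
    ext x
    constructor
    · rintro ⟨⟨a, b⟩, hab, ⟨c, d⟩, ⟨hc, hd⟩, e⟩
      simp only [Set.mem_singleton_iff] at hd
      subst hd
      simp only [Prod.mk_add_mk, add_zero, Prod.mk.injEq] at e
      obtain ⟨rfl, rfl⟩ := e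
      exact ⟨a, hab, c, hc, rfl⟩
    · rintro ⟨a, ha, c, hc, rfl⟩
      exact ⟨(a, y), ha, (c, 0), ⟨hc, rfl⟩, by simp⟩
  rw [hadd]
  rcases S.eq_empty_or_nonempty with h | ⟨x, hx⟩
  · have hy : y ∉ Prod.snd '' s := by
      rintro ⟨⟨a, b⟩, hab, rfl⟩
      exact Set.notMem_empty a (h ▸ hab)
    rw [h, Set.empty_add, Set.indicator_of_notMem hy]
    simp
  · have hy : y ∈ Prod.snd '' s := ⟨(x, y), hx, rfl⟩
    have hSc : IsCompact S := by
      refine (hc.image continuous_fst).of_isClosed_subset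
        (hc.isClosed.preimage (by fun_prop)) fun a ha => ⟨(a, y), ha, rfl⟩
    have hSconv : Convex ℝ S := by
      intro a ha b hb t u ht hu htu
      have h1 := hs ha hb ht hu htu
      have h2 : t • (a, y) + u • (b, y) = (t • a + u • b, y) := by
        simp [← add_mul, htu]
      rwa [h2] at h1
    have hSI := eq_Icc_of_connected_compact (hSconv.isConnected ⟨x, hx⟩) hSc
    have hle : sInf S ≤ sSup S := by
      rw [hSI] at hx
      exact hx.1.trans hx.2
    rw [hSI, Set.Icc_add_Icc hle zero_le_one, Set.indicator_of_mem hy, Real.volume_Icc,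
      Real.volume_Icc, Pi.one_apply, ← ENNReal.ofReal_one,
      ← ENNReal.ofReal_add (sub_nonneg.2 hle) zero_le_one]
    congr 1
    ring

/-- Sweeping a planar convex set along a horizontal unit segment increases its area by its
height. -/
theorem volume_add_segment_prod {s : Set (ℝ × ℝ)} (hs : Convex ℝ s) (hc : IsCompact s) :
    volume (s + Set.Icc (0 : ℝ) 1 ×ˢ {(0 : ℝ)}) = volume s + volume (Prod.snd '' s) := by
  have hc' : IsCompact (s + Set.Icc (0 : ℝ) 1 ×ˢ {(0 : ℝ)}) :=
    hc.add (isCompact_Icc.prod isCompact_singleton)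
  have hi : MeasurableSet (Prod.snd '' s) := (hc.image continuous_snd).isClosed.measurableSet
  rw [Measure.volume_eq_prod, Measure.prod_apply_symm hc'.isClosed.measurableSet,
    Measure.prod_apply_symm hc.isClosed.measurableSet]
  simp_rw [volume_preimage_add_segment hs hc]
  rw [lintegral_add_right _ (measurable_one.indicator hi), lintegral_indicator_one hi]

theorem volume_add_segment_plane {s : Set Plane} (hs : Convex ℝ s) (hc : IsCompact s) :
    volume (s + segment ℝ 0 (EuclideanSpace.single 0 1)) =
      volume s + volume ((fun x : Plane => x 1) '' s) := by
  let φ : Plane →ₗ[ℝ] ℝ × ℝ :=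
    { toFun := fun x => (x 0, x 1)
      map_add' := fun _ _ => rfl
      map_smul' := fun _ _ => rfl }
  have hφ : ∀ x, φ x = (x 0, x 1) := fun _ => rfl
  have hinj : Function.Injective φ := fun x y h =>
    plane_ext (congrArg Prod.fst h) (congrArg Prod.snd h)
  have hcont : Continuous φ := φ.continuous_of_finiteDimensional
  have hmp : MeasurePreserving φ volume volume :=
    (volume_preserving_finTwoArrow ℝ).comp (PiLp.volume_preserving_ofLp (Fin 2))
  have hvol : ∀ t : Set Plane, IsCompact t → volume (φ '' t) = volume t := fun t ht => by
    rw [← hmp.measure_preimage (ht.image hcont).isClosed.measurableSet.nullMeasurableSet,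
      Set.preimage_image_eq _ hinj]
  have hseg : φ '' segment ℝ 0 (EuclideanSpace.single 0 1) = Set.Icc (0 : ℝ) 1 ×ˢ {(0 : ℝ)} := by
    rw [segment_eq_image]
    ext ⟨a, b⟩
    constructor
    · rintro ⟨_, ⟨r, hr, rfl⟩, e⟩
      have e1 : r = a := by simpa [hφ] using congrArg Prod.fst e
      have e2 : (0 : ℝ) = b := by simpa [hφ] using congrArg Prod.snd e
      exact ⟨e1 ▸ hr, e2.symm⟩
    · rintro ⟨ha, hb⟩
      refine ⟨_, ⟨a, ha, rfl⟩, ?_⟩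
      simp only [Set.mem_singleton_iff] at hb
      subst hb
      simp [hφ]
  have hsegc : IsCompact (segment ℝ (0 : Plane) (EuclideanSpace.single 0 1)) := by
    rw [← convexHull_pair (𝕜 := ℝ)]
    exact (Set.toFinite {(0 : Plane), EuclideanSpace.single 0 1}).isCompact_convexHull ℝ
  rw [← hvol _ (hc.add hsegc), ← hvol _ hc, Set.image_add, hseg,
    volume_add_segment_prod (hs.linear_image φ) (hc.image hcont), Set.image_image]
  rfl

/-- Sweeping a planar convex set along a segment. -/
theorem volume_add_segment {K : Set Plane} (hK : Convex ℝ K) (hc : IsCompact K)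
    (hne : K.Nonempty) (t : Plane) :
    volume (K + segment ℝ 0 t) =
      volume K + ENNReal.ofReal
        (supportFun K (quarterTurn t) + supportFun K (-quarterTurn t)) := by
  by_cases ht : t = 0
  · subst ht
    have h0 : quarterTurn 0 = 0 := plane_ext (by simp) (by simp)
    have h1 : supportFun K 0 = 0 := by
      simpa using supportFun_smul_right hc hne le_rfl (0 : Plane)
    simp [h0, h1]
  -- The similarity taking the first basis vector to t and the second to Jt, with determinant |t|²,
  -- reduces the claim to a horizontal unit segment.
  let A : Matrix (Fin 2) (Fin 2) ℝ := !![t 0, -t 1; t 1, t 0]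
  let f : Plane →ₗ[ℝ] Plane := A.toEuclideanLin
  have hf : ∀ x : Plane, f x = x 0 • t + x 1 • quarterTurn t := fun x =>
    plane_ext (by simp [f, A, Matrix.toLpLin_apply, dotProduct, mul_comm])
      (by simp [f, A, Matrix.toLpLin_apply, dotProduct, mul_comm])
  set n : ℝ := t 0 * t 0 + t 1 * t 1 with hn
  have hnt : n = inner ℝ t t := (inner_plane t t).symm
  have hn0 : 0 < n := hnt ▸ real_inner_self_pos.2 ht
  have hdet : LinearMap.det f = n := by
    simp only [f, Matrix.toLpLin_eq_toLin, LinearMap.det_toLin, A, Matrix.det_fin_two_of]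
    ring
  have hvol : ∀ s : Set Plane, volume (f '' s) = ENNReal.ofReal n * volume s := fun s => by
    rw [Measure.addHaar_image_linearMap, hdet, abs_of_pos hn0]
  let e : Plane ≃ₗ[ℝ] Plane := f.equivOfDetNeZero (hdet ▸ hn0.ne')
  have he : ∀ x, f (e.symm x) = x := fun x => e.apply_symm_apply x
  obtain ⟨s, hs⟩ : ∃ s, s = e.symm '' K := ⟨_, rfl⟩
  have hfs : f '' s = K := by
    rw [hs, Set.image_image]
    simp [he]
  have hsc : IsCompact s := hs ▸ hc.image (e.symm.toLinearMap.continuous_of_finiteDimensional)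
  have hsconv : Convex ℝ s := hs ▸ hK.linear_image e.symm.toLinearMap
  have hft : f (EuclideanSpace.single 0 1) = t := by simp [hf]
  have hsum : f '' (s + segment ℝ 0 (EuclideanSpace.single 0 1)) = K + segment ℝ 0 t := by
    rw [Set.image_add, hfs]
    congr 1
    have := image_segment ℝ f.toAffineMap 0 (EuclideanSpace.single 0 1)
    simpa [hft] using this
  -- The height of s, scaled by n, is the length of the projection of K on Jt, which is the sum of
  -- two support values.
  have hproj : (fun z => inner ℝ (quarterTurn t) z) '' K = n • ((fun x : Plane => x 1) '' s) := by
    conv_lhs => rw [← hfs]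
    rw [Set.image_image (fun z => inner ℝ (quarterTurn t) z) f s, ← Set.image_smul,
      Set.image_image _ (fun x : Plane => x 1) s]
    refine Set.image_congr fun x _ => ?_
    rw [hf, inner_add_right, real_inner_smul_right, real_inner_smul_right, real_inner_comm,
      inner_quarterTurn_self, real_inner_self_eq_norm_sq, norm_quarterTurn,
      ← real_inner_self_eq_norm_sq, ← hnt, smul_eq_mul]
    ring
  have hlen : ENNReal.ofReal n * volume ((fun x : Plane => x 1) '' s) = ENNReal.ofReal
      (supportFun K (quarterTurn t) + supportFun K (-quarterTurn t)) := by
    have h1 := Measure.addHaar_smul volume n ((fun x : Plane => x 1) '' s)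
    rw [← hproj, image_inner_eq_Icc hc hne hK, Real.volume_Icc, Module.finrank_self, pow_one,
      abs_of_pos hn0, sub_neg_eq_add] at h1
    exact h1.symm
  rw [← hsum, hvol, volume_add_segment_plane hsconv hsc, mul_add, hlen, ← hvol, hfs]

theorem convexHull_union_vadd {K : Set Plane} (hK : Convex ℝ K) (v w : Plane) :
    convexHull ℝ ((v +ᵥ K) ∪ (w +ᵥ K)) = v +ᵥ (K + segment ℝ 0 (w - v)) := by
  have h1 : (v +ᵥ K) ∪ (w +ᵥ K) = K + {v, w} := by
    rw [add_comm, Set.insert_eq, Set.union_add, Set.singleton_add, Set.singleton_add]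
    rfl
  have h2 : segment ℝ v w = v +ᵥ segment ℝ 0 (w - v) := by
    have := segment_translate_image ℝ v 0 (w - v)
    rw [add_zero, add_sub_cancel] at this
    exact this.symm
  rw [h1, convexHull_add, hK.convexHull_eq, convexHull_pair, h2, add_vadd_comm]

theorem volume_convexHull_union_vadd {K : Set Plane} (hK : Convex ℝ K) (hc : IsCompact K)
    (hne : K.Nonempty) (v w : Plane) :
    volume (convexHull ℝ ((v +ᵥ K) ∪ (w +ᵥ K))) =
      volume K + ENNReal.ofReal
        (2 * supportFun ((1 / 2 : ℝ) • (K - K)) (quarterTurn (w - v))) := by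
  rw [convexHull_union_vadd hK, measure_vadd, volume_add_segment hK hc hne,
    supportFun_halfDiff hc hne]

/-! ### The equivalences. -/

theorem translativeConstantVolume_iff {K : Set Plane} (hc : Convex ℝ K) (hK : IsCompact K)
    (hi : (interior K).Nonempty) :
    TranslativeConstantVolume K ↔ IsRadonCurve (frontier ((1 / 2 : ℝ) • (K - K))) := by
  have hD := isSymmetricBody_halfDiff hc hK hi
  have hne : K.Nonempty := hi.mono interior_subset
  simp only [TranslativeConstantVolume, touching_iff hc hK hi,
    volume_convexHull_union_vadd hc hK hne]
  rw [isRadonCurve_frontier_iff hD]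
  set D := (1 / 2 : ℝ) • (K - K)
  have hnorm : ∀ t : Plane, t ≠ 0 → gauge D ((2 / gauge D t) • t) = 2 := fun t ht => by
    have h0 := hD.gauge_pos ht
    rw [gauge_smul_of_nonneg (div_nonneg two_pos.le h0.le), smul_eq_mul, div_mul_cancel₀ _ h0.ne']
  constructor
  · rintro ⟨c, h⟩
    obtain ⟨e, he⟩ := exists_ne (0 : Plane)
    set t := (2 / gauge D e) • e with ht_def
    have ht : gauge D t = 2 := hnorm e he
    have hconst : ∀ x, gauge D x = 2 →
        supportFun D (quarterTurn x) = supportFun D (quarterTurn t) := by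
      intro x hx
      have h1 := (h 0 x (by simpa using hx)).trans (h 0 t (by simpa using ht)).symm
      rw [ENNReal.add_right_inj hK.measure_lt_top.ne, sub_zero, sub_zero] at h1
      have hnn : ∀ z, 0 ≤ supportFun D z := fun z => by
        by_cases hz : z = 0
        · rw [hz, hD.supportFun_zero]
        · exact (hD.supportFun_pos hz).le
      rw [ENNReal.ofReal_eq_ofReal_iff (mul_nonneg two_pos.le (hnn _))
        (mul_nonneg two_pos.le (hnn _))] at h1
      linarith
    have ht0 : quarterTurn t ≠ 0 := by
      intro h0
      have h2 := norm_quarterTurn t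
      rw [h0, norm_zero] at h2
      rw [norm_eq_zero.1 h2.symm, gauge_zero] at ht
      norm_num at ht
    -- The factor 1/2 compensates for `gauge D t = 2`. Applying `hconst` to a multiple of Jz
    -- produces the support value at -z, and D is symmetric.
    refine ⟨supportFun D (quarterTurn t) / 2, half_pos (hD.supportFun_pos ht0), fun z => ?_⟩
    by_cases hz : z = 0
    · have h0 : quarterTurn 0 = 0 := plane_ext (by simp) (by simp)
      rw [hz, h0, gauge_zero, hD.supportFun_zero, mul_zero]
    have hz' : quarterTurn z ≠ 0 := by
      rw [← norm_ne_zero_iff, norm_quarterTurn, norm_ne_zero_iff]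
      exact hz
    have h0 := hD.gauge_pos hz'
    have h1 := hconst _ (hnorm _ hz')
    rw [quarterTurn_smul, quarterTurn_quarterTurn,
      supportFun_smul_right hD.isCompact hD.nonempty (div_nonneg two_pos.le h0.le),
      hD.supportFun_neg] at h1
    rw [← h1]
    field_simp
  · rintro ⟨l, -, h⟩
    refine ⟨volume K + ENNReal.ofReal (2 * (l * 2)), fun v w hvw => ?_⟩
    rw [h, quarterTurn_quarterTurn, hD.gauge_neg, hvw]

theorem isRadonNorm_gauge_and_constantWidth {K : Set Plane} (hc : Convex ℝ K) (hK : IsCompact K)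
    (hi : (interior K).Nonempty) (h : IsRadonCurve (frontier ((1 / 2 : ℝ) • (K - K)))) :
    ∃ p : Seminorm ℝ Plane, IsRadonNorm p ∧ HasConstantWidth p K := by
  have hD := isSymmetricBody_halfDiff hc hK hi
  have hne : K.Nonempty := hi.mono interior_subset
  have hfun := supportFun_halfDiff hK hne
  set D := (1 / 2 : ℝ) • (K - K)
  have hbal : Balanced ℝ D := (balanced_iff_neg_mem hD.convex).2 fun _ => hD.neg_mem.2
  let p := gaugeSeminorm hbal hD.convex hD.absorbent
  have hp : ∀ x, p x = gauge D x := fun _ => rfl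
  have hp0 : ∀ x, p x = 0 → x = 0 := fun x hx => hD.gauge_eq_zero_iff.1 hx
  have hball : {x | p x ≤ 1} = D := Set.ext fun x => hD.gauge_le_one_iff
  -- In the norm with unit ball D every width of K is 2, since K - K = 2D.
  refine ⟨p, ⟨hp0, ?_⟩, 2, fun u hu => ?_⟩
  · rwa [← frontier_seminorm hp0, hball]
  · rw [minkowskiWidth_eq hp0 hK hne hu, hball, ← hfun, mul_div_assoc,
      div_self (hD.supportFun_pos hu).ne', mul_one]

theorem isRadonCurve_of_constantWidth {K : Set Plane} (hc : Convex ℝ K) (hK : IsCompact K)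
    (hi : (interior K).Nonempty) {p : Seminorm ℝ Plane} (hp : IsRadonNorm p)
    (h : HasConstantWidth p K) : IsRadonCurve (frontier ((1 / 2 : ℝ) • (K - K))) := by
  have hD := isSymmetricBody_halfDiff hc hK hi
  have hne : K.Nonempty := hi.mono interior_subset
  have hfun := supportFun_halfDiff hK hne
  set D := (1 / 2 : ℝ) • (K - K)
  obtain ⟨hp0, hR⟩ := hp
  obtain ⟨c, h⟩ := h
  have hB := isSymmetricBody_seminorm hp0
  rw [← frontier_seminorm hp0, isRadonCurve_frontier_iff hB] at hR
  set B := {x | p x ≤ 1}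
  obtain ⟨l, hl, hR⟩ := hR
  have hw : ∀ u, u ≠ 0 → supportFun D u = c / 2 * supportFun B u := fun u hu => by
    have h1 := h u hu
    rw [minkowskiWidth_eq hp0 hK hne hu, ← hfun, div_eq_iff (hB.supportFun_pos hu).ne'] at h1
    linarith
  have hc0 : 0 < c / 2 := by
    obtain ⟨e, he⟩ := exists_ne (0 : Plane)
    have h1 := hD.supportFun_pos he
    rw [hw e he] at h1
    exact pos_of_mul_pos_left h1 (hB.supportFun_pos he).le
  have hcB := hB.smul hc0.ne'
  have heq : ∀ u, supportFun D u = supportFun ((c / 2) • B) u := fun u => by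
    by_cases hu : u = 0
    · rw [hu, hD.supportFun_zero, hcB.supportFun_zero]
    · rw [hw u hu, supportFun_smul_left hB.isCompact hB.nonempty hc0.le]
  have hDB : D = (c / 2) • B := Set.Subset.antisymm
    (subset_of_supportFun_le hD.isCompact hcB.isCompact hcB.convex hcB.nonempty
      fun u => (heq u).le)
    (subset_of_supportFun_le hcB.isCompact hD.isCompact hD.convex hD.nonempty
      fun u => (heq u).ge)
  rw [isRadonCurve_frontier_iff hD]
  -- Dilation by c / 2 multiplies the support function by c / 2 and divides the gauge by it.
  refine ⟨c / 2 * (c / 2) * l, by positivity, fun z => ?_⟩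
  rw [hDB, supportFun_smul_left hB.isCompact hB.nonempty hc0.le, hR,
    gauge_smul_left_of_nonneg hc0.le, Pi.smul_apply, smul_eq_mul]
  field_simp

theorem theorem2 (K : ConvexBody Plane) (hK : (interior (K : Set Plane)).Nonempty) :
    List.TFAE [
      TranslativeConstantVolume (K : Set Plane),
      IsRadonCurve (frontier ((1 / 2 : ℝ) • ((K : Set Plane) - (K : Set Plane)))),
      ∃ p : Seminorm ℝ Plane, IsRadonNorm p ∧ HasConstantWidth p (K : Set Plane)] := by
  tfae_have 1 ↔ 2 := translativeConstantVolume_iff K.convex K.isCompact hK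
  tfae_have 2 → 3 := isRadonNorm_gauge_and_constantWidth K.convex K.isCompact hK
  tfae_have 3 → 2 := fun ⟨_, hp, hw⟩ =>
    isRadonCurve_of_constantWidth K.convex K.isCompact hK hp hw
  tfae_finish
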